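/- Fix integers $d,k,n\ge 0$ and a set $\mathcal C$. A structural encoding scheme $S=(f_A,f_R)$ assigns to every simple undirected graph $G$ (on a node set $\{v_1,\dots,v_m\}$) and all nodes $v,u$ an absolute encoding $f_A(v,G)\in\mathbb R^k$ and a relative encoding $f_R(v,u,G)\in\mathcal C$; it is regular if $f_R(v,v,G)\ne f_R(v,u,G)$ whenever $u\neq v$. Let $\mathcal X\subset\mathbb R^d$, let $\Phi_0:\mathcal X\times\mathbb R^k\to\mathcal X$ be measurable in its first argument, and let $\Phi$ map finite multisets of elements of $\mathcal X\times\mathcal C$ to $\mathcal X$ (in the SEG-WL isomorphism test $\Phi_0$ and $\Phi$ are injective; the statement holds with or without injectivity). For a graph $G$ with nodes $v_1,\dots,v_n$ and labels $h_0:V\to\mathcal X$, $S$-SEG-WL computes $$g_0(v)=\Phi_0(h_0(v),f_A(v,G)),\qquad g_s(v)=\Phi\big(\{\!\{(g_{s-1}(u),f_R(v,u,G)):u\in V\}\!\}\big)\quad(s\ge 1),$$ and $f_t(X,G)=[g_t(v_1),\dots,g_t(v_n)]\in\mathbb R^{d\times n}$, where $X=[h_0(v_1),\dots,h_0(v_n)]\in\mathcal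 X^n$. A bias-GT network with $S$ starts from $l_0(v)=W(h_0(v),f_A(v,G))+b\in\mathbb R^d$ and applies finitely many Transformer layers of hidden dimension $d$ (with any fixed number of heads, key and value dimensions and feed-forward width), without layer normalization. Each layer consists of multi-head softmax attention with residual connection, in which head $i$ uses the attention logits $\langle W_Q^i x_v,W_K^i x_u\rangle/\sqrt d+E_i(f_R(v,u,G))$ with a learnable embedding $E_i:\mathcal C\to\mathbb R$, followed by a node-wise one-hidden-layer ReLU network with residual connection. Its output $g(X,G)\in\mathbb R^{d\times n}$ stacks the final feature vectors of all nodes. For functions $f,g$ of $X\in\mathcal X^n$ and a graph $G$ on $n$ nodes put $$\mathsf d_p(f,g)=\max_G\Big(\int_{\mathcal X^n}\|f(X,G)-g(X,G)\|_p^p\,dX\Big)^{1/p},$$ with Lebesgue measure and the entrywise $\ell^p$ norm. **Theorem.** Let $S$ be regular, $1<p<\infty$, $\epsilon>0$ and $t\ge 0$. Assume that (i) $\mathcal X$ is compact, and (ii) for every $w\in\mathcal C^n$ the map $(x_1,\dots,x_n)\mapsto\Phi(\{\!\{(x_i,w_i):1\le i\le n\}\!\})$ on $\mathcal X^n$ extends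 to a continuous, compactly supported function $\mathbb R^{d\times n}\to\mathbb R^d$. Then there is a bias-GT network $g$ with $S$ such that $\mathsf d_p(f_t,g)<\epsilon$. -/

import Mathlib

open MeasureTheory
open scoped ENNReal

noncomputable section

namespace SEGWL

/-- Numerical vectors with `d` entries. -/
abbrev Vec (d : ℕ) : Type := Fin d → ℝ

/-- A structural encoding scheme `S = (f_A, f_R)`, for graphs of every order `n` with node set
`{0, …, n - 1}`. Absolute encodings are numerical vectors with `k` entries (they are concatenated
with node features); relative encodings may take values in any type `C`. -/
structure StructuralEncoding (k : ℕ) (C : Type*) where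
  /-- the absolute encoding `f_A(v, G)` -/
  absEnc : ∀ {n : ℕ}, SimpleGraph (Fin n) → Fin n → Vec k
  /-- the relative encoding `f_R(v, u, G)` -/
  relEnc : ∀ {n : ℕ}, SimpleGraph (Fin n) → Fin n → Fin n → C

/-- `S` is regular if `f_R(v, v, G) ≠ f_R(v, u, G)` whenever `u ≠ v`. -/
def StructuralEncoding.Regular {k : ℕ} {C : Type*} (S : StructuralEncoding k C) : Prop :=
  ∀ (n : ℕ) (G : SimpleGraph (Fin n)) (v u : Fin n), u ≠ v → S.relEnc G v v ≠ S.relEnc G v u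

/-- The multiset `{{ (x u, w u) : u }}` of pairs of a node label and a relative encoding. -/
def pairs {d n : ℕ} {C : Type*} {𝒳 : Set (Vec d)} (x : Fin n → 𝒳) (w : Fin n → C) :
    Multiset (𝒳 × C) :=
  Finset.univ.val.map fun u => (x u, w u)

/-- The `S`-SEG-WL labels `g_t(v)` of the graph `G` with input labels `h₀`, for the hash functions
`Φ₀` and `Φ`. The isomorphism test uses injective `Φ₀` and `Φ`; the recursion itself makes sense
for arbitrary ones, and no injectivity is built in. -/
def label {d k n : ℕ} {C : Type*} {𝒳 : Set (Vec d)} (S : StructuralEncoding k C)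
    (Φ₀ : 𝒳 × Vec k → 𝒳) (Φ : Multiset (𝒳 × C) → 𝒳)
    (G : SimpleGraph (Fin n)) (h₀ : Fin n → 𝒳) : ℕ → Fin n → 𝒳
  | 0 => fun v => Φ₀ (h₀ v, S.absEnc G v)
  | t + 1 => fun v => Φ (pairs (label S Φ₀ Φ G h₀ t) (S.relEnc G v))

/-- The function `f_t` of `t`-iteration `S`-SEG-WL on graphs of order `n`: it stacks the labels of
all nodes, as vectors in `ℝ^d`. -/
def labelFun {d k n : ℕ} {C : Type*} {𝒳 : Set (Vec d)} (S : StructuralEncoding k C)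
    (Φ₀ : 𝒳 × Vec k → 𝒳) (Φ : Multiset (𝒳 × C) → 𝒳) (t : ℕ)
    (h₀ : Fin n → 𝒳) (G : SimpleGraph (Fin n)) : Fin n → Vec d :=
  fun v => (label S Φ₀ Φ G h₀ t v : Vec d)

/-- `Φ` extends continuously in the node labels, for graphs of order `n`: for each fixed vector
`w` of relative encodings, `x ↦ Φ {{ (x u, w u) : u }}` is the restriction to `𝒳^n` of a
continuous function with compact support on `ℝ^{d × n}`. -/
def ExtendsContinuously {d : ℕ} {C : Type*} {𝒳 : Set (Vec d)} (n : ℕ)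
    (Φ : Multiset (𝒳 × C) → 𝒳) : Prop :=
  ∀ w : Fin n → C, ∃ F : (Fin n → Vec d) → Vec d,
    Continuous F ∧ HasCompactSupport F ∧
      ∀ x : Fin n → 𝒳, F (fun u => (x u : Vec d)) = (Φ (pairs x w) : Vec d)

/-- The softmax of a vector of logits. -/
def softmax {n : ℕ} (l : Fin n → ℝ) (u : Fin n) : ℝ :=
  Real.exp (l u) / ∑ r, Real.exp (l r)

/-- The parameters of one attention head: hidden dimension `d`, key dimension `dk`, value
dimension `dv`, and the embedding (a lookup) of relative encodings as attention biases. -/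
structure Head (d dk dv : ℕ) (C : Type*) where
  WQ : Matrix (Fin dk) (Fin d) ℝ
  WK : Matrix (Fin dk) (Fin d) ℝ
  WV : Matrix (Fin dv) (Fin d) ℝ
  embedding : C → ℝ

/-- The biased logits `a_{vu}` of a head: scaled dot product plus embedded relative encoding. -/
def Head.logit {d dk dv n : ℕ} {C : Type*} (a : Head d dk dv C) (α : Fin n → Fin n → C)
    (X : Fin n → Vec d) (v u : Fin n) : ℝ :=
  (a.WQ.mulVec (X v) ⬝ᵥ a.WK.mulVec (X u)) / Real.sqrt d + a.embedding (α v u)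

/-- The output of a head at node `v`. -/
def Head.eval {d dk dv n : ℕ} {C : Type*} (a : Head d dk dv C) (α : Fin n → Fin n → C)
    (X : Fin n → Vec d) (v : Fin n) : Vec dv :=
  ∑ u, softmax (a.logit α X v) u • a.WV.mulVec (X u)

/-- The parameters of one Transformer layer with `h` heads and `r` hidden feed-forward units. -/
structure Layer (d h dk dv r : ℕ) (C : Type*) where
  head : Fin h → Head d dk dv C
  WO : Matrix (Fin d) (Fin h × Fin dv) ℝ
  W₁ : Matrix (Fin r) (Fin d) ℝ
  b₁ : Vec r
  W₂ : Matrix (Fin d) (Fin r) ℝ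
  b₂ : Vec d

/-- Biased multi-head attention with residual connection: the concatenated heads are projected
by `WO`. -/
def Layer.attention {d h dk dv r n : ℕ} {C : Type*} (l : Layer d h dk dv r C)
    (α : Fin n → Fin n → C) (X : Fin n → Vec d) : Fin n → Vec d :=
  fun v => X v + l.WO.mulVec fun i => (l.head i.1).eval α X v i.2

/-- The node-wise ReLU feed-forward network with residual connection. -/
def Layer.feedForward {d h dk dv r n : ℕ} {C : Type*} (l : Layer d h dk dv r C)
    (H : Fin n → Vec d) : Fin n → Vec d :=
  fun v => H v + (l.W₂.mulVec (fun i => max ((l.W₁.mulVec (H v) + l.b₁) i) 0) + l.b₂)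

/-- One Transformer layer. -/
def Layer.eval {d h dk dv r n : ℕ} {C : Type*} (l : Layer d h dk dv r C)
    (α : Fin n → Fin n → C) (X : Fin n → Vec d) : Fin n → Vec d :=
  l.feedForward (l.attention α X)

/-- The parameters of a bias-GT network with node features in `ℝ^d` and absolute encodings in
`ℝ^k`: a linear layer for the input embedding, and finitely many Transformer layers of hidden
dimension `d`. -/
structure BiasGT (d k h dk dv r : ℕ) (C : Type*) where
  W : Matrix (Fin d) (Fin d ⊕ Fin k) ℝ
  b : Vec d
  layers : List (Layer d h dk dv r C)

/-- The input embedding `Linear(Concat(h₀(v), f_A(v, G)))`. -/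
def BiasGT.embed {d k h dk dv r n : ℕ} {C : Type*} (g : BiasGT d k h dk dv r C)
    (S : StructuralEncoding k C) (X₀ : Fin n → Vec d) (G : SimpleGraph (Fin n)) :
    Fin n → Vec d :=
  fun v => g.W.mulVec (Sum.elim (X₀ v) (S.absEnc G v)) + g.b

/-- The function computed by an `S`-bias-GT network: the stacked feature vectors of all nodes
after the last layer. The first layer of the list is applied first. -/
def BiasGT.eval {d k h dk dv r n : ℕ} {C : Type*} (g : BiasGT d k h dk dv r C)
    (S : StructuralEncoding k C) (X₀ : Fin n → Vec d) (G : SimpleGraph (Fin n)) :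
    Fin n → Vec d :=
  g.layers.foldl (fun X l => l.eval (S.relEnc G) X) (g.embed S X₀ G)

/-- Lebesgue measure of `ℝ^{d × n}` on `𝒳^n`. -/
def featureMeasure {d : ℕ} (𝒳 : Set (Vec d)) (n : ℕ) : Measure (Fin n → 𝒳) :=
  (volume : Measure (Fin n → Vec d)).comap fun x u => (x u : Vec d)

/-- The distance `d_p(f, g) = max_G (∫ ‖f(X, G) - g(X, G)‖_p^p dX)^{1/p}` of two functions of a
feature matrix `X ∈ 𝒳^n` and a graph `G` of order `n`, with the entrywise `ℓ^p` norm. -/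
def dp {d n : ℕ} {𝒳 : Set (Vec d)} (p : ℝ)
    (f g : (Fin n → 𝒳) → SimpleGraph (Fin n) → Fin n → Vec d) : ℝ≥0∞ :=
  ⨆ G : SimpleGraph (Fin n),
    (∫⁻ X, ∑ v, ∑ i, ‖f X G v i - g X G v i‖ₑ ^ p ∂(featureMeasure 𝒳 n)) ^ (1 / p)

end SEGWL

end

/-!
Both sides of the estimate are governed by finitely many configurations. The input embedding
translates a node feature `x ∈ 𝒳` by a multiple of a coordinate vector that depends on the absolute
encoding; since `𝒳` is bounded and only finitely many absolute encodings occur on graphs of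
order `n`, the translates of `𝒳` can be made disjoint (`shiftFeature`). A ReLU layer then rounds the
coordinates to finitely many values. It is exact outside short gaps, and for a fine enough grid the
rounded features determine the initial labels `Φ₀ (x, a)` up to a small error on a set given by a
weak Lusin theorem. The nodes of a graph also receive pairwise distinct rounded features, except
on a set of small measure, because coincidences between two nodes form a null set
(`exists_quantized_labels`).

For the remaining, finitely many, configurations the recursion is computed exactly
(`exists_realizable_refineLabels`). A head with zero query and key matrices outputs
`∑ w(c u) κ(y u) / ∑ w(c u)` at a node, where `y u` is the feature of node `u`, `c u` its relative
encoding, and the values `κ` and the weights `w` are free. For a generic choice this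
average determines the multiset of the pairs `(y u, c u)`: clearing denominators, two rows with equal
averages give a polynomial identity in `κ` and `w`, and a nontrivial identity fails at a generic
point (`exists_separating_attention`). The identity can be trivial for different multisets only if
the relative encodings are constant along a row, and this is what regularity excludes if there are at
least two nodes. A generic multiple of the average keeps the residual term readable. Thus each round
keeps the nodes distinct and makes the next label a function of the feature, and a final
interpolation on a finite set of features produces the labels themselves.

Labels depend continuously on the initial labels, so an approximation of the initial labels is
enough. A last layer clamps all outputs to a fixed box, so that small exceptional sets
contribute little to the integral (`exists_dp_lt`).
-/

namespace SEGWL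

/-! ### Points in general position -/

/-- Finitely many nonzero real polynomials have a common point of non-vanishing all of whose
coordinates are positive. Every "generic choice" of weights below is an instance of this. -/
theorem exists_pos_eval_ne_zero {σ ι : Type*} [Finite ι] (P : ι → MvPolynomial σ ℝ)
    (hP : ∀ i, P i ≠ 0) :
    ∃ x : σ → ℝ, (∀ s, 0 < x s) ∧ ∀ i, MvPolynomial.eval x (P i) ≠ 0 := by
  classical
  have := Fintype.ofFinite ι
  by_contra! h
  have hprod : ∏ i, P i = 0 := by
    refine MvPolynomial.funext_set (fun _ => Set.Ioi (0 : ℝ)) (fun _ => Set.Ioi_infinite 0) ?_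
    intro x hx
    obtain ⟨i, hi⟩ := h x fun s => hx s trivial
    rw [map_prod, map_zero]
    exact Finset.prod_eq_zero (Finset.mem_univ i) hi
  obtain ⟨i, -, hi⟩ := Finset.prod_eq_zero_iff.1 hprod
  exact hP i hi

theorem exists_dotProduct_injOn {d : ℕ} {F : Set (Vec d)} (hF : F.Finite) :
    ∃ u : Vec d, Set.InjOn (fun y => u ⬝ᵥ y) F := by
  classical
  have := hF.to_subtype
  let P : {q : F × F // q.1 ≠ q.2} → MvPolynomial (Fin d) ℝ := fun q =>
    ∑ i, MvPolynomial.C ((q.1.1 : Vec d) i - (q.1.2 : Vec d) i) * MvPolynomial.X i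
  have hP : ∀ q, P q ≠ 0 := by
    rintro ⟨⟨y, z⟩, hne⟩ h0
    refine hne (Subtype.ext (funext fun i => ?_))
    have := congrArg (MvPolynomial.eval (Pi.single i (1 : ℝ))) h0
    simpa [P, Pi.single_apply, sub_eq_zero] using this
  obtain ⟨u, -, hu⟩ := exists_pos_eval_ne_zero P hP
  refine ⟨u, fun y hy z hz hyz => ?_⟩
  by_contra hne
  refine hu ⟨(⟨y, hy⟩, ⟨z, hz⟩), fun h => hne (congrArg Subtype.val h)⟩ ?_
  simp only [dotProduct] at hyz
  simp only [P, map_sum, map_mul, MvPolynomial.eval_C, MvPolynomial.eval_X, sub_mul,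
    Finset.sum_sub_distrib]
  rw [sub_eq_zero]
  simpa only [mul_comm] using hyz

/-! ### Networks with one hidden layer -/

/-- Functions `ℝ^d → ℝ^d` computed by a ReLU network with one hidden layer. Each entry
`(a, b, w)` of the list is a hidden unit with input weights `a`, bias `b` and output weights `w`. -/
def Shallow {d : ℕ} (f : Vec d → Vec d) : Prop :=
  ∃ (L : List (Vec d × ℝ × Vec d)) (c : Vec d),
    ∀ y, f y = (L.map fun q => max (q.1 ⬝ᵥ y + q.2.1) 0 • q.2.2).sum + c

theorem Shallow.const {d : ℕ} (c : Vec d) : Shallow fun _ : Vec d => c :=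
  ⟨[], c, fun y => by simp⟩

theorem Shallow.ridge {d : ℕ} (a : Vec d) (b : ℝ) (w : Vec d) :
    Shallow fun y : Vec d => max (a ⬝ᵥ y + b) 0 • w :=
  ⟨[(a, b, w)], 0, fun y => by simp⟩

theorem Shallow.add {d : ℕ} {f g : Vec d → Vec d} (hf : Shallow f) (hg : Shallow g) :
    Shallow fun y => f y + g y := by
  obtain ⟨L, c, hL⟩ := hf
  obtain ⟨L', c', hL'⟩ := hg
  refine ⟨L ++ L', c + c', fun y => ?_⟩
  beta_reduce
  rw [hL, hL', List.map_append, List.sum_append]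
  abel

theorem Shallow.sum {d : ℕ} {ι : Type*} (s : Finset ι) {f : ι → Vec d → Vec d}
    (hf : ∀ i, Shallow (f i)) : Shallow fun y => ∑ i ∈ s, f i y := by
  classical
  induction s using Finset.induction_on with
  | empty => simpa using Shallow.const (0 : Vec d)
  | insert i s hi ih => simpa only [Finset.sum_insert hi] using (hf i).add ih

theorem Shallow.neg_id {d : ℕ} : Shallow fun y : Vec d => -y := by
  have h := Shallow.sum Finset.univ fun i : Fin d =>
    (Shallow.ridge (Pi.single i 1) 0 (-Pi.single i 1)).add
      (Shallow.ridge (Pi.single i (-1)) 0 (Pi.single i 1))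
  convert h using 2 with y
  ext j
  simp only [Finset.sum_apply, Pi.add_apply, Pi.smul_apply, Pi.neg_apply, smul_eq_mul,
    single_dotProduct, Pi.single_apply]
  rw [Finset.sum_eq_single j (fun i _ hi => by simp [hi.symm]) (by simp)]
  rcases le_total 0 (y j) with hj | hj
  · simp [hj]
  · simp [hj]

/-- A ReLU network with one hidden layer can take prescribed vector values at finitely many points
of a line: units switching on one after the other correct the values from left to right. -/
theorem exists_shallow_eqOn_line {d : ℕ} (u : Vec d) (ψ : ℝ → Vec d) (T : Finset ℝ) :
    ∃ g : ℝ → Vec d, Shallow (fun y : Vec d => g (u ⬝ᵥ y)) ∧ ∀ s ∈ T, g s = ψ s := by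
  classical
  induction T using Finset.induction_on_max with
  | empty => exact ⟨fun _ => 0, Shallow.const 0, by simp⟩
  | insert t T hT ih =>
    obtain ⟨g, hg, hgT⟩ := ih
    obtain ⟨m, hmt, hm⟩ : ∃ m < t, ∀ s ∈ T, s ≤ m := by
      rcases T.eq_empty_or_nonempty with rfl | hne
      · exact ⟨t - 1, by simp, by simp⟩
      · exact ⟨T.max' hne, hT _ (T.max'_mem hne), fun s hs => T.le_max' s hs⟩
    refine ⟨fun s => g s + max (s + -m) 0 • ((t - m)⁻¹ • (ψ t - g t)),
      hg.add (Shallow.ridge u (-m) _), fun s hs => ?_⟩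
    rcases Finset.mem_insert.1 hs with rfl | hs
    · have hpos : 0 < s - m := sub_pos.2 hmt
      simp only [← sub_eq_add_neg, max_eq_left hpos.le, smul_smul, mul_inv_cancel₀ hpos.ne',
        one_smul]
      abel
    · have : s + -m ≤ 0 := by linarith [hm s hs]
      simp [max_eq_right this, hgT s hs]

theorem exists_shallow_eqOn {d : ℕ} {F : Set (Vec d)} (hF : F.Finite) (φ : Vec d → Vec d) :
    ∃ f : Vec d → Vec d, Shallow f ∧ Set.EqOn f φ F := by
  classical
  obtain ⟨u, hu⟩ := exists_dotProduct_injOn hF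
  obtain ⟨g, hg, hgT⟩ := exists_shallow_eqOn_line u
    (fun s => φ (Function.invFunOn (fun y => u ⬝ᵥ y) F s)) (hF.image fun y => u ⬝ᵥ y).toFinset
  refine ⟨_, hg, fun y hy => ?_⟩
  rw [hgT _ (by simpa using ⟨y, hy, rfl⟩), hu.leftInvOn_invFunOn hy]

/-- Scalar functions `ℝ → ℝ` computed by a ReLU network with one hidden layer act
coordinatewise as such a network. -/
theorem Shallow.coordinatewise {d : ℕ} {ι : Type*} [Fintype ι] (a b w : ι → ℝ) (c : ℝ) :
    Shallow fun (y : Vec d) i => (∑ j, w j * max (a j * y i + b j) 0) + c := by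
  have h := (Shallow.sum Finset.univ fun i : Fin d => Shallow.sum Finset.univ fun j : ι =>
    Shallow.ridge (Pi.single i (a j)) (b j) (Pi.single i (w j))).add (Shallow.const fun _ => c)
  convert h using 2 with y
  ext k
  simp only [Finset.sum_apply, Pi.add_apply, Pi.smul_apply, smul_eq_mul,
    single_dotProduct, Pi.single_apply]
  rw [Finset.sum_eq_single k (fun i _ hi => by simp [hi.symm]) (by simp)]
  simp [mul_comm]

/-! ### Functions computed by stacks of layers -/

/-- `T` is computed, on graphs of order `n`, by a stack of Transformer layers with one head and
scalar keys and values. The width of the feed-forward networks may be any sufficiently large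
number; this makes stacks composable. The first argument of `T` is the matrix of relative
encodings. -/
def Realizable {d n : ℕ} {C : Type*}
    (T : (Fin n → Fin n → C) → (Fin n → Vec d) → Fin n → Vec d) : Prop :=
  ∃ r₀ : ℕ, ∀ r ≥ r₀, ∃ ls : List (Layer d 1 1 1 r C),
    ∀ α X, ls.foldl (fun X l => l.eval α X) X = T α X

variable {d k n : ℕ} {C : Type*} {𝒳 : Set (Vec d)}

theorem Realizable.id : Realizable (d := d) (n := n) (C := C) fun _ X => X :=
  ⟨0, fun _ _ => ⟨[], fun _ _ => rfl⟩⟩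

theorem Realizable.comp {T T' : (Fin n → Fin n → C) → (Fin n → Vec d) → Fin n → Vec d}
    (hT' : Realizable T') (hT : Realizable T) : Realizable fun α X => T' α (T α X) := by
  obtain ⟨r, hr⟩ := hT
  obtain ⟨r', hr'⟩ := hT'
  refine ⟨max r r', fun s hs => ?_⟩
  obtain ⟨l, hl⟩ := hr s (le_trans (le_max_left _ _) hs)
  obtain ⟨l', hl'⟩ := hr' s (le_trans (le_max_right _ _) hs)
  exact ⟨l ++ l', fun α X => by rw [List.foldl_append, hl, hl']⟩

/-- Attention contributes nothing if its output matrix is zero, and the residual connection is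
cancelled by adding the negative of the identity, itself a network with one hidden layer. -/
theorem Realizable.nodewise {f : Vec d → Vec d} (hf : Shallow f) :
    Realizable (C := C) fun (_ : Fin n → Fin n → C) X v => f (X v) := by
  obtain ⟨L, c, hL⟩ := hf.add Shallow.neg_id
  refine ⟨L.length, fun r hr => ?_⟩
  -- unused hidden units have weight zero
  obtain ⟨L', hlen, hL'⟩ : ∃ L' : List (Vec d × ℝ × Vec d), L'.length = r ∧
      ∀ y, (L'.map fun q => max (q.1 ⬝ᵥ y + q.2.1) 0 • q.2.2).sum + c = f y + -y := by
    refine ⟨L ++ List.replicate (r - L.length) (0, 0, 0), by simp; omega, fun y => ?_⟩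
    rw [← show _ = f y + -y from (hL y).symm]
    simp
  subst hlen
  refine ⟨[{ head := fun _ => ⟨0, 0, 0, fun _ => 0⟩, WO := 0,
             W₁ := Matrix.of fun i => L'[i].1, b₁ := fun i => L'[i].2.1,
             W₂ := Matrix.of fun k i => L'[i].2.2 k, b₂ := c }], fun α X => ?_⟩
  ext v k
  have h := congrFun (hL' (X v)) k
  rw [← List.ofFn_getElem (xs := L'), List.map_ofFn, List.sum_ofFn] at h
  simp only [Layer.eval, Layer.feedForward, Layer.attention, List.foldl_cons, List.foldl_nil,
    Matrix.zero_mulVec, add_zero, Pi.add_apply]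
  simp only [Pi.add_apply, Finset.sum_apply, Function.comp, Pi.smul_apply, smul_eq_mul,
    Pi.neg_apply] at h
  simp only [Matrix.mulVec, dotProduct, Matrix.of_apply] at h ⊢
  simp only [Fin.getElem_fin]
  rw [Finset.sum_congr rfl fun i _ => mul_comm _ _]
  linarith

/-- A head with zero key and query matrices averages one coordinate of the features, with weights
that depend on the relative encodings only. -/
theorem Realizable.attend (i₀ : Fin d) (lam : ℝ) (E : C → ℝ) :
    Realizable fun (α : Fin n → Fin n → C) X v =>
      X v + Pi.single i₀ (lam * ∑ u, softmax (fun u => E (α v u)) u * X u i₀) := by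
  refine ⟨0, fun r _ => ⟨[{
    head := fun _ => ⟨0, 0, Matrix.of fun _ => Pi.single i₀ 1, E⟩
    WO := Matrix.of fun k _ => (Pi.single i₀ lam : Vec d) k
    W₁ := 0, b₁ := 0, W₂ := 0, b₂ := 0 }], fun α X => ?_⟩⟩
  have hlogit : ∀ v, Head.logit (⟨0, 0, Matrix.of fun _ => Pi.single i₀ 1, E⟩ : Head d 1 1 C)
      α X v = fun u => E (α v u) := fun v => by
    ext u; simp [Head.logit]
  ext v k
  simp only [Layer.eval, Layer.feedForward, Layer.attention, List.foldl_cons, List.foldl_nil,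
    Matrix.zero_mulVec, add_zero, Pi.add_apply, Head.eval, hlogit]
  simp [Matrix.mulVec, dotProduct, Pi.single_apply, Finset.sum_apply]

/-! ### Attention that separates neighbourhoods -/

/-- The hypothesis says that two attention outputs (with residual connection) agree for all
values `κ` of the labels, all weights `w` of the relative encodings and all output scalings `lam`,
denominators cleared. Indicator functions `κ` match the nodes of the two rows by their labels. If
the encodings of two matched nodes differed, a weight vanishing only on the first of them would
force the first row sum to be zero, so that the first row would be constant, against `hc`. -/
theorem multiset_eq_of_forall_average_eq {Y C : Type*} {n : ℕ} {y y' : Fin n → Y}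
    {c c' : Fin n → C} (v v' : Fin n) (hy : Function.Injective y) (hy' : Function.Injective y')
    (hc : ∃ u u', c u ≠ c u')
    (h : ∀ (lam : ℝ) (κ : Y → ℝ) (w : C → ℝ),
      (κ (y v) * ∑ u, w (c u) + lam * ∑ u, w (c u) * κ (y u)) * ∑ u, w (c' u) =
        (κ (y' v') * ∑ u, w (c' u) + lam * ∑ u, w (c' u) * κ (y' u)) * ∑ u, w (c u)) :
    y v = y' v' ∧ Finset.univ.val.map (fun u => (y u, c u)) =
      Finset.univ.val.map fun u => (y' u, c' u) := by
  classical
  have hn : (n : ℝ) ≠ 0 := Nat.cast_ne_zero.2 fun h0 => by subst h0; exact v.elim0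
  have hv : y v = y' v' := by
    by_contra hne
    have := h 0 (fun z => if z = y v then 1 else 0) fun _ => 1
    simp [Ne.symm hne, hn] at this
  have havg : ∀ (κ : Y → ℝ) (w : C → ℝ), (∑ u, w (c u) * κ (y u)) * ∑ u, w (c' u) =
      (∑ u, w (c' u) * κ (y' u)) * ∑ u, w (c u) := fun κ w => by
    have := h 1 κ w
    rw [hv] at this
    linarith
  have hex : ∀ u, ∃ u', y' u' = y u := fun u => by
    by_contra! hne
    have := havg (fun z => if z = y u then 1 else 0) fun _ => 1
    simp [hne, hn, hy.eq_iff] at this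
  choose σ hσ using hex
  have hσi : Function.Injective σ := fun a b hab => hy (by rw [← hσ, ← hσ, hab])
  have hw : ∀ u (w : C → ℝ), w (c u) * ∑ u, w (c' u) = w (c' (σ u)) * ∑ u, w (c u) := by
    intro u w
    have := havg (fun z => if z = y u then 1 else 0) w
    have h' : ∀ x, (y' x = y u) = (x = σ u) := fun x => by rw [← hσ, hy'.eq_iff]
    simpa [h', hy.eq_iff] using this
  have hcc : ∀ u, c' (σ u) = c u := fun u => by
    by_contra hne
    have := hw u fun z => if z = c u then 0 else 1
    simp only [if_true, zero_mul, hne, if_false, one_mul] at this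
    have hz := (Finset.sum_eq_zero_iff_of_nonneg (fun i _ => by split_ifs <;> norm_num)).1 this.symm
    have hall : ∀ x, c x = c u := fun x => by
      by_contra hx
      simpa [hx] using hz x (Finset.mem_univ x)
    obtain ⟨a, b, hab⟩ := hc
    exact hab (by rw [hall a, hall b])
  refine ⟨hv, ?_⟩
  let e : Fin n ≃ Fin n := Equiv.ofBijective σ (Finite.injective_iff_bijective.1 hσi)
  conv_rhs => rw [← Multiset.map_univ_val_equiv e, Multiset.map_map]
  exact Multiset.map_congr rfl fun u _ => by simp [e, hσ, hcc]

/-- For generic values `κ` of the labels, biases `E` and output scaling `lam`, attention with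
residual connection separates finitely many rows: the output determines the label of the
node itself and the multiset of pairs of a label and a relative encoding. -/
theorem exists_separating_attention {ι Y C : Type*} [Finite ι] {n : ℕ} (y : ι → Fin n → Y)
    (c : ι → Fin n → C) (v : ι → Fin n) (hy : ∀ i, Function.Injective (y i))
    (hc : ∀ i, ∃ u u', c i u ≠ c i u') :
    ∃ (lam : ℝ) (κ : Y → ℝ) (E : C → ℝ), ∀ i j,
      κ (y i (v i)) + lam * ∑ u, softmax (fun u => E (c i u)) u * κ (y i u) =
        κ (y j (v j)) + lam * ∑ u, softmax (fun u => E (c j u)) u * κ (y j u) →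
      y i (v i) = y j (v j) ∧ Finset.univ.val.map (fun u => (y i u, c i u)) =
        Finset.univ.val.map fun u => (y j u, c j u) := by
  classical
  -- variables: the scaling `none`, the weights of encodings and the values of labels
  let W : C → MvPolynomial (Option (C ⊕ Y)) ℝ := fun a => MvPolynomial.X (some (Sum.inl a))
  let K : Y → MvPolynomial (Option (C ⊕ Y)) ℝ := fun a => MvPolynomial.X (some (Sum.inr a))
  let num : ι → MvPolynomial (Option (C ⊕ Y)) ℝ := fun i =>
    K (y i (v i)) * ∑ u, W (c i u) + MvPolynomial.X none * ∑ u, W (c i u) * K (y i u)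
  let P : {q : ι × ι // ¬ (y q.1 (v q.1) = y q.2 (v q.2) ∧
      Finset.univ.val.map (fun u => (y q.1 u, c q.1 u)) =
        Finset.univ.val.map fun u => (y q.2 u, c q.2 u))} → MvPolynomial (Option (C ⊕ Y)) ℝ :=
    fun q => num q.1.1 * ∑ u, W (c q.1.2 u) - num q.1.2 * ∑ u, W (c q.1.1 u)
  have hP : ∀ q, P q ≠ 0 := by
    rintro ⟨⟨i, j⟩, hne⟩ h0
    refine hne (multiset_eq_of_forall_average_eq (v i) (v j) (hy i) (hy j) (hc i)
      fun lam κ w => ?_)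
    have := congrArg (MvPolynomial.eval fun o => o.elim lam (Sum.elim w κ)) h0
    simpa [P, num, W, K, sub_eq_zero] using this
  obtain ⟨x, hx, hxP⟩ := exists_pos_eval_ne_zero P hP
  refine ⟨x none, fun a => x (some (Sum.inr a)), fun a => Real.log (x (some (Sum.inl a))),
    fun i j hij => ?_⟩
  by_contra hne
  refine hxP ⟨(i, j), hne⟩ ?_
  have key : ∀ i, MvPolynomial.eval x (num i) =
      (x (some (Sum.inr (y i (v i)))) + x none * ∑ u,
        softmax (fun u => Real.log (x (some (Sum.inl (c i u))))) u * x (some (Sum.inr (y i u)))) *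
        ∑ u, x (some (Sum.inl (c i u))) := fun i => by
    have hpos : 0 < ∑ u, x (some (Sum.inl (c i u))) :=
      Finset.sum_pos (fun _ _ => hx _) ⟨v i, Finset.mem_univ _⟩
    simp only [num, K, W, map_add, map_mul, map_sum, MvPolynomial.eval_X, softmax,
      Real.exp_log (hx _), div_mul_eq_mul_div, ← Finset.sum_div]
    field_simp
  simp only [P, map_sub, map_mul, map_sum, key, hij, W, MvPolynomial.eval_X]
  ring

/-! ### Iterated labels -/

/-- The `S`-SEG-WL recursion started at arbitrary labels `g₀`. -/
def refineLabels (S : StructuralEncoding k C)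
    (Φ : Multiset (𝒳 × C) → 𝒳) (G : SimpleGraph (Fin n)) (g₀ : Fin n → 𝒳) : ℕ → Fin n → 𝒳
  | 0 => g₀
  | t + 1 => fun v => Φ (pairs (refineLabels S Φ G g₀ t) (S.relEnc G v))

theorem label_eq_refineLabels (S : StructuralEncoding k C)
    (Φ₀ : 𝒳 × Vec k → 𝒳) (Φ : Multiset (𝒳 × C) → 𝒳) (G : SimpleGraph (Fin n))
    (h₀ : Fin n → 𝒳) (t : ℕ) :
    label S Φ₀ Φ G h₀ t = refineLabels S Φ G (fun v => Φ₀ (h₀ v, S.absEnc G v)) t := by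
  induction t with
  | zero => rfl
  | succ t ih => funext v; simp only [label, refineLabels, ih]

theorem continuous_refineLabels (S : StructuralEncoding k C)
    {Φ : Multiset (𝒳 × C) → 𝒳} (hΦ : ExtendsContinuously n Φ) (G : SimpleGraph (Fin n)) (t : ℕ) :
    Continuous fun g₀ : Fin n → 𝒳 => refineLabels S Φ G g₀ t := by
  induction t with
  | zero => exact continuous_id
  | succ t ih =>
    refine continuous_pi fun v => ?_
    obtain ⟨F, hF, -, hFΦ⟩ := hΦ (S.relEnc G v)
    refine Continuous.subtype_mk (f := fun g₀ : Fin n → 𝒳 =>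
      ((Φ (pairs (refineLabels S Φ G g₀ t) (S.relEnc G v)) : 𝒳) : Vec d)) ?_
      fun _ => Subtype.coe_prop _
    simp only [← hFΦ]
    fun_prop

/-- One round of refinement: if the features of the nodes are pairwise distinct in each of
finitely many configurations, a stack of layers can give features that determine
the old feature of the node and the multiset of its neighbourhood. -/
theorem exists_realizable_neighbourhood {Ω : Type*} [Finite Ω] (i₀ : Fin d)
    (α : Ω → Fin n → Fin n → C) (Y : Ω → Fin n → Vec d) (hY : ∀ ω, Function.Injective (Y ω))
    (hα : ∀ ω v, ∃ u u', α ω v u ≠ α ω v u') :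
    ∃ T : (Fin n → Fin n → C) → (Fin n → Vec d) → Fin n → Vec d, Realizable T ∧
      ∀ ω v ω' v', T (α ω) (Y ω) v = T (α ω') (Y ω') v' →
        Y ω v = Y ω' v' ∧ Finset.univ.val.map (fun u => (Y ω u, α ω v u)) =
          Finset.univ.val.map fun u => (Y ω' u, α ω' v' u) := by
  obtain ⟨lam, κ, E, hE⟩ := exists_separating_attention (fun q : Ω × Fin n => Y q.1)
    (fun q => α q.1 q.2) (fun q => q.2) (fun q => hY q.1) fun q => hα q.1 q.2
  obtain ⟨f, hf, hfκ⟩ := exists_shallow_eqOn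
    (Set.finite_range fun q : Ω × Fin n => Y q.1 q.2) fun z => Pi.single i₀ (κ z)
  have hval : ∀ ω v, f (Y ω v) i₀ = κ (Y ω v) := fun ω v => by
    rw [hfκ ⟨(ω, v), rfl⟩]
    exact Pi.single_eq_same _ _
  refine ⟨_, (Realizable.attend i₀ lam E).comp (Realizable.nodewise hf),
    fun ω v ω' v' h => hE (ω, v) (ω', v') ?_⟩
  simpa [hval] using congrFun h i₀

/-- A stack of layers computes `t` rounds of the recursion exactly, on all graphs of order `n` at
once, if the features of distinct nodes are distinct and come from a finite set `F`. -/
theorem exists_realizable_refineLabels (hd : 0 < d) (S : StructuralEncoding k C) (hS : S.Regular)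
    (Φ : Multiset (𝒳 × C) → 𝒳) {F : Set (Vec d)} (hF : F.Finite) (ρ : Vec d → 𝒳) (t : ℕ) :
    ∃ T : (Fin n → Fin n → C) → (Fin n → Vec d) → Fin n → Vec d, Realizable T ∧
      ∀ (G : SimpleGraph (Fin n)) (y : Fin n → Vec d), Function.Injective y → (∀ v, y v ∈ F) →
        ∀ v, T (S.relEnc G) y v = refineLabels S Φ G (fun v => ρ (y v)) t v := by
  classical
  -- the configurations: a graph, and distinct features in `F`
  let Ω := {q : SimpleGraph (Fin n) × (Fin n → F) //
    Function.Injective fun v => (q.2 v : Vec d)}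
  have := hF.to_subtype
  let y : Ω → Fin n → Vec d := fun ω v => ω.1.2 v
  let L : Ω → ℕ → Fin n → 𝒳 := fun ω s => refineLabels S Φ ω.1.1 (fun v => ρ (y ω v)) s
  have stage : ∀ s, ∃ T : (Fin n → Fin n → C) → (Fin n → Vec d) → Fin n → Vec d,
      Realizable T ∧ ∀ ω v ω' v',
        T (S.relEnc ω.1.1) (y ω) v = T (S.relEnc ω'.1.1) (y ω') v' →
          y ω v = y ω' v' ∧ L ω s v = L ω' s v' := by
    intro s
    rcases le_or_gt n 1 with hn | hn
    · -- at most one node: the feature determines the whole configuration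
      refine ⟨_, Realizable.id, fun ω v ω' v' h => ⟨h, ?_⟩⟩
      have hsub : Subsingleton (Fin n) := Fin.subsingleton_iff_le_one.2 hn
      have hωω : ω = ω' := by
        refine Subtype.ext (Prod.ext (SimpleGraph.ext ?_) (funext fun u => Subtype.ext ?_))
        · ext a b
          exact iff_of_false (fun h => h.ne (Subsingleton.elim _ _))
            fun h => h.ne (Subsingleton.elim _ _)
        · rw [Subsingleton.elim u v]
          exact h.trans (congrArg (y ω') (Subsingleton.elim _ _))
      rw [hωω, Subsingleton.elim v v']
    induction s with
    | zero =>
      refine ⟨_, Realizable.id, fun ω v ω' v' h => ⟨h, ?_⟩⟩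
      exact congrArg ρ h
    | succ s ih =>
      obtain ⟨T, hT, hTL⟩ := ih
      have hα : ∀ (ω : Ω) v, ∃ u u', S.relEnc ω.1.1 v u ≠ S.relEnc ω.1.1 v u' := fun ω v => by
        have : Nontrivial (Fin n) := Fin.nontrivial_iff_two_le.2 hn
        obtain ⟨u, hu⟩ := exists_ne v
        exact ⟨v, u, hS n _ v u hu⟩
      obtain ⟨T', hT', hT'L⟩ := exists_realizable_neighbourhood ⟨0, hd⟩
        (fun ω : Ω => S.relEnc ω.1.1) (fun ω => T (S.relEnc ω.1.1) (y ω))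
        (fun ω a b hab => ω.2 (hTL ω a ω b hab).1) hα
      refine ⟨_, hT'.comp hT, fun ω v ω' v' h => ?_⟩
      obtain ⟨h1, h2⟩ := hT'L ω v ω' v' h
      refine ⟨(hTL _ _ _ _ h1).1, ?_⟩
      -- the label of a node is a function of its feature
      obtain ⟨φ, hφ⟩ : ∃ φ : Vec d → 𝒳, ∀ ω u, φ (T (S.relEnc ω.1.1) (y ω) u) = L ω s u := by
        have hfac : Function.FactorsThrough (fun q : Ω × Fin n => L q.1 s q.2)
            fun q => T (S.relEnc q.1.1.1) (y q.1) q.2 := fun q q' hq => (hTL _ _ _ _ hq).2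
        exact ⟨Function.extend (fun q : Ω × Fin n => T (S.relEnc q.1.1.1) (y q.1) q.2)
          (fun q => L q.1 s q.2) fun _ => L ω s v, fun ω u => hfac.extend_apply _ (ω, u)⟩
      have h3 := congrArg (Multiset.map (Prod.map φ id)) h2
      simp only [Multiset.map_map, Function.comp_def, Prod.map, hφ, id] at h3
      exact congrArg Φ h3
  obtain ⟨T, hT, hTL⟩ := stage t
  let out : Ω × Fin n → Vec d := fun q => T (S.relEnc q.1.1.1) (y q.1) q.2
  obtain ⟨f, hf, hfv⟩ := exists_shallow_eqOn (Set.finite_range out)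
    (Function.extend out (fun q => (L q.1 t q.2 : Vec d)) fun _ => 0)
  refine ⟨_, (Realizable.nodewise hf).comp hT, fun G x hx hxF v => ?_⟩
  have hfac : Function.FactorsThrough (fun q : Ω × Fin n => (L q.1 t q.2 : Vec d)) out :=
    fun q q' hq => congrArg Subtype.val (hTL _ _ _ _ hq).2
  let ω : Ω := ⟨(G, fun v => ⟨x v, hxF v⟩), hx⟩
  have := hfv ⟨(ω, v), rfl⟩
  rw [hfac.extend_apply _ (ω, v)] at this
  exact this

open Filter Topology

/-! ### Quantization -/

/-- The short intervals `(m, m + δ)`, `m ∈ T`, on which a continuous approximation of a step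
function with jumps at the points of `T` takes intermediate values. -/
def gaps (T : Finset ℝ) (δ : ℝ) : Set ℝ := {s | ∃ m ∈ T, m < s ∧ s < m + δ}

/-- A difference of two ReLUs is an exact step away from a gap. -/
theorem ramp_eq_ite {δ m s : ℝ} (hδ : 0 < δ) (h : ¬ (m < s ∧ s < m + δ)) :
    max (δ⁻¹ * s + -(δ⁻¹ * m)) 0 - max (δ⁻¹ * s + (-(δ⁻¹ * m) - 1)) 0 =
      if m < s then 1 else 0 := by
  have hmul : δ⁻¹ * δ = 1 := inv_mul_cancel₀ hδ.ne'
  have hδ' : 0 < δ⁻¹ := inv_pos.2 hδ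
  split_ifs with hs
  · have h1 : m + δ ≤ s := not_lt.1 fun h' => h ⟨hs, h'⟩
    have h2 := mul_le_mul_of_nonneg_left h1 hδ'.le
    rw [mul_add, hmul] at h2
    rw [max_eq_left (by linarith), max_eq_left (by linarith)]
    ring
  · have h2 := mul_le_mul_of_nonneg_left (not_lt.1 hs) hδ'.le
    rw [max_eq_right (by linarith), max_eq_right (by linarith)]
    ring

/-- A network with one hidden layer maps the points of a box that avoid the gaps to a finite set,
and identifies only points that are `η`-close. The gaps may be arbitrarily short. -/
theorem exists_quantizer (d : ℕ) (R η : ℝ) (hη : 0 < η) :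
    ∃ T : Finset ℝ, ∀ δ > 0, ∃ Q : Vec d → Vec d, Shallow Q ∧
      (Q '' {z | ∀ i, |z i| ≤ R ∧ z i ∉ gaps T δ}).Finite ∧
      ∀ z z' : Vec d, (∀ i, |z i| ≤ R ∧ z i ∉ gaps T δ) → (∀ i, |z' i| ≤ R ∧ z' i ∉ gaps T δ) →
        Q z = Q z' → ∀ i, |z i - z' i| ≤ η := by
  classical
  let T : Finset ℝ := (Finset.range (⌈2 * R / η⌉₊ + 1)).image fun j : ℕ => -R + j * η
  have hT : ∀ s s' : ℝ, |s| ≤ R → |s'| ≤ R → η < s' - s → ∃ m ∈ T, s ≤ m ∧ m < s' := by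
    intro s s' hs hs' hss
    obtain ⟨h1, h2⟩ := abs_le.1 hs
    have h0 : 0 ≤ (s + R) / η := div_nonneg (by linarith) hη.le
    have hle := Nat.le_ceil ((s + R) / η)
    have hlt := Nat.ceil_lt_add_one h0
    refine ⟨-R + ⌈(s + R) / η⌉₊ * η, Finset.mem_image.2 ⟨_, Finset.mem_range.2 ?_, rfl⟩, ?_, ?_⟩
    · refine Nat.lt_succ_of_le (Nat.ceil_le_ceil ?_)
      gcongr
      linarith
    · rw [div_le_iff₀ hη] at hle
      linarith
    · have : (⌈(s + R) / η⌉₊ : ℝ) * η < ((s + R) / η + 1) * η := by gcongr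
      rw [add_mul, div_mul_cancel₀ _ hη.ne'] at this
      linarith
  refine ⟨T, fun δ hδ => ?_⟩
  obtain ⟨Q, hQ, hQe⟩ : ∃ Q : Vec d → Vec d, Shallow Q ∧ ∀ z i, Q z i =
      (∑ j : T ⊕ T, Sum.elim (fun _ => (1 : ℝ)) (fun _ => -1) j * max (δ⁻¹ * z i +
        Sum.elim (fun m : T => -(δ⁻¹ * (m : ℝ))) (fun m : T => -(δ⁻¹ * (m : ℝ)) - 1) j) 0) + 0 :=
    ⟨_, Shallow.coordinatewise (fun _ => δ⁻¹) _ _ 0, fun _ _ => rfl⟩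
  refine ⟨Q, hQ, ?_⟩
  have hcard : ∀ z i, z i ∉ gaps T δ → Q z i = ((T.filter (· < z i)).card : ℝ) := by
    intro z i hs
    rw [hQe, Fintype.sum_sum_type]
    simp only [Sum.elim_inl, Sum.elim_inr, one_mul, neg_mul, Finset.sum_neg_distrib, add_zero]
    rw [← sub_eq_add_neg, ← Finset.sum_sub_distrib,
      Finset.sum_congr rfl fun (m : T) _ => ramp_eq_ite hδ fun h => hs ⟨m, m.2, h⟩,
      Finset.sum_coe_sort T fun m => if m < z i then (1 : ℝ) else 0]
    simp
  constructor
  · refine (Set.Finite.pi' fun _ : Fin d =>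
      (Set.finite_Iic T.card).image fun j : ℕ => (j : ℝ)).subset ?_
    rintro _ ⟨z, hz, rfl⟩ i
    exact ⟨_, Finset.card_filter_le _ _, (hcard z i (hz i).2).symm⟩
  · have key : ∀ s s' : ℝ, |s| ≤ R → |s'| ≤ R →
        (T.filter (· < s)).card = (T.filter (· < s')).card → s' - s ≤ η := by
      intro s s' hs hs' h
      by_contra! hlt
      obtain ⟨m, hm, h1, h2⟩ := hT s s' hs hs' hlt
      refine (Finset.card_lt_card ?_).ne h
      refine (Finset.ssubset_iff_of_subset fun x hx => ?_).2
        ⟨m, Finset.mem_filter.2 ⟨hm, h2⟩, fun hx => (Finset.mem_filter.1 hx).2.not_ge h1⟩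
      obtain ⟨hx1, hx2⟩ := Finset.mem_filter.1 hx
      exact Finset.mem_filter.2 ⟨hx1, by linarith⟩
    intro z z' hz hz' h i
    have h' := congrFun h i
    rw [hcard z i (hz i).2, hcard z' i (hz' i).2, Nat.cast_inj] at h'
    rw [abs_sub_le_iff]
    exact ⟨key _ _ (hz' i).1 (hz i).1 h'.symm, key _ _ (hz i).1 (hz' i).1 h'⟩

theorem shallow_clamp {d : ℕ} (M : ℝ) (hM : 0 ≤ M) :
    ∃ f : Vec d → Vec d, Shallow f ∧ (∀ y i, |f y i| ≤ M) ∧ ∀ y, (∀ i, |y i| ≤ M) → f y = y := by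
  refine ⟨_, Shallow.coordinatewise (ι := Bool) (fun _ => 1) (fun j => if j then M else -M)
    (fun j => if j then 1 else -1) (-M), fun y i => ?_, fun y hy => funext fun i => ?_⟩
  · simp only [Fintype.sum_bool, if_true, one_mul]
    simp only [Bool.false_eq_true, if_false]
    rw [abs_le]
    rcases max_cases (y i + M) 0 with h | h <;> rcases max_cases (y i + -M) 0 with h' | h' <;>
      constructor <;> linarith
  · simp only [Fintype.sum_bool, if_true, one_mul]
    simp only [Bool.false_eq_true, if_false]
    obtain ⟨h1, h2⟩ := abs_le.1 (hy i)
    rw [max_eq_left (by linarith), max_eq_right (by linarith)]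
    ring

/-! ### Exceptional sets of small measure -/

/-- A weak form of Lusin's theorem: a bounded measurable function on a compact space is, up
to an error `τ`, uniformly continuous on a set with complement of measure at most `β`. -/
theorem exists_measurableSet_dist_le {X E : Type*} [MetricSpace X] [CompactSpace X]
    [MeasurableSpace X] [BorelSpace X] [NormedAddCommGroup E] [NormedSpace ℝ E]
    (μ : Measure X) [IsFiniteMeasure μ] {f : X → E} (hf : AEStronglyMeasurable f μ) {M : ℝ}
    (hM : ∀ x, ‖f x‖ ≤ M) {β : ℝ≥0∞} (hβ : β ≠ 0) {τ : ℝ} (hτ : 0 < τ) :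
    ∃ K : Set X, μ Kᶜ ≤ β ∧ ∃ η > 0, ∀ x ∈ K, ∀ x' ∈ K, dist x x' ≤ η →
      dist (f x) (f x') ≤ τ := by
  have hτ' : ENNReal.ofReal (τ / 3) ≠ 0 := by simpa using hτ
  obtain ⟨g, hg, hgi⟩ := (Integrable.of_bound hf M (ae_of_all _ hM)
    ).exists_boundedContinuous_lintegral_sub_le (ε := ENNReal.ofReal (τ / 3) * β) (by positivity)
  obtain ⟨η, hη, hgη⟩ := Metric.uniformContinuous_iff.1
    (CompactSpace.uniformContinuous_of_continuous g.continuous) (τ / 3) (by positivity)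
  refine ⟨{x | ‖f x - g x‖ₑ < ENNReal.ofReal (τ / 3)}, ?_, η / 2, by positivity, ?_⟩
  · have h := mul_meas_ge_le_lintegral₀ (hf.sub hgi.1).enorm (ENNReal.ofReal (τ / 3))
    simp only [Set.compl_ofPred, not_lt]
    exact (ENNReal.mul_le_mul_iff_right hτ' ENNReal.ofReal_ne_top).1 (h.trans hg)
  · intro x hx x' hx' hxx'
    have hlt : ∀ x, ‖f x - g x‖ₑ < ENNReal.ofReal (τ / 3) → dist (f x) (g x) < τ / 3 :=
      fun x hx => by
        rw [dist_eq_norm]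
        rwa [← ofReal_norm, ENNReal.ofReal_lt_ofReal_iff (by positivity)] at hx
    have h1 := hlt x hx
    have h2 := hlt x' hx'
    have h3 := hgη (hxx'.trans_lt (by linarith))
    have h4 := dist_triangle4 (f x) (g x) (g x') (f x')
    rw [dist_comm (g x')] at h4
    linarith

/-- Finitely many families of sets that shrink to null sets as `δ → 0` have a union of small
measure for small `δ`. -/
theorem eventually_measure_iUnion_le {α ι : Type*} [Finite ι] [MeasurableSpace α]
    (μ : Measure α) [IsFiniteMeasure μ] (s : ι → ℝ → Set α) (hs : ∀ i δ, MeasurableSet (s i δ))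
    (hmono : ∀ i, Monotone (s i)) (h0 : ∀ i, μ (⋂ δ > 0, s i δ) = 0) {β : ℝ≥0∞} (hβ : β ≠ 0) :
    ∀ᶠ δ in 𝓝[>] (0 : ℝ), μ (⋃ i, s i δ) ≤ β := by
  have := Fintype.ofFinite ι
  have ht : Tendsto (fun δ => ∑ i, μ (s i δ)) (𝓝[>] (0 : ℝ)) (𝓝 0) := by
    rw [show (0 : ℝ≥0∞) = ∑ i : ι, 0 by simp]
    refine tendsto_finsetSum _ fun i _ => ?_
    rw [← h0 i]
    exact tendsto_measure_biInter_gt (fun δ _ => (hs i δ).nullMeasurableSet)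
      (fun _ _ _ h => hmono i h) ⟨1, by simp, measure_ne_top _ _⟩
  filter_upwards [ht.eventually_le_const (pos_iff_ne_zero.2 hβ)] with δ hδ
  exact (measure_iUnion_fintype_le μ fun i => s i δ).trans hδ

theorem measurableEmbedding_coe (h𝒳 : IsCompact 𝒳) :
    MeasurableEmbedding fun (x : Fin n → 𝒳) u => (x u : Vec d) := by
  have := isCompact_iff_compactSpace.1 h𝒳
  refine (Continuous.isClosedEmbedding (by fun_prop) fun x y h => ?_).measurableEmbedding
  exact funext fun u => Subtype.ext (congrFun h u)

theorem isFiniteMeasure_featureMeasure (h𝒳 : IsCompact 𝒳) :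
    IsFiniteMeasure (featureMeasure 𝒳 n) := by
  refine ⟨?_⟩
  rw [featureMeasure, (measurableEmbedding_coe h𝒳).comap_apply]
  have : IsCompact (Set.pi Set.univ fun _ : Fin n => 𝒳) := isCompact_univ_pi fun _ => h𝒳
  refine (measure_mono ?_).trans_lt this.measure_lt_top
  rintro _ ⟨x, -, rfl⟩ u -
  exact (x u).2

/-- Two given nodes almost never have features that differ by a prescribed amount in a given
coordinate. -/
theorem featureMeasure_sub_eq (h𝒳 : IsCompact 𝒳) {u v : Fin n} (huv : u ≠ v) (i : Fin d) (c : ℝ) :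
    featureMeasure 𝒳 n {x | (x u : Vec d) i - (x v : Vec d) i = c} = 0 := by
  rw [featureMeasure, (measurableEmbedding_coe h𝒳).comap_apply]
  let L : (Fin n → Vec d) →ₗ[ℝ] ℝ :=
    (LinearMap.proj i : Vec d →ₗ[ℝ] ℝ) ∘ₗ
      ((LinearMap.proj u : (Fin n → Vec d) →ₗ[ℝ] Vec d) - LinearMap.proj v)
  have hne : (AffineSubspace.mk' c ⊥).comap L.toAffineMap ≠ ⊤ := fun h => by
    have : Pi.single u (Pi.single i (c + 1)) ∈ (AffineSubspace.mk' c ⊥).comap L.toAffineMap :=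
      h ▸ AffineSubspace.mem_top ..
    simp [L, AffineSubspace.mem_comap, AffineSubspace.mem_mk', huv.symm] at this
  refine measure_mono_null ?_ (Measure.addHaar_affineSubspace volume _ hne)
  rintro _ ⟨x, hx, rfl⟩
  have hx : (x u : Vec d) i - (x v : Vec d) i = c := hx
  simp [L, AffineSubspace.mem_mk', hx]

/-- Bounded functions that are uniformly close outside a set of small measure are close in the
distance `dp`. -/
theorem exists_dp_lt (h𝒳 : IsCompact 𝒳) {p : ℝ} (hp : 0 < p) {ε : ℝ} (hε : 0 < ε) (M : ℝ) :
    ∃ τ : ℝ, 0 < τ ∧ ∃ β : ℝ≥0∞, β ≠ 0 ∧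
      ∀ f g : (Fin n → 𝒳) → SimpleGraph (Fin n) → Fin n → Vec d,
        (∀ X G v i, |f X G v i| ≤ M) → (∀ X G v i, |g X G v i| ≤ M) →
        (∀ G, ∃ B, featureMeasure 𝒳 n B ≤ β ∧
          ∀ X ∉ B, ∀ v i, |f X G v i - g X G v i| ≤ τ) →
        dp p f g < ENNReal.ofReal ε := by
  have := isFiniteMeasure_featureMeasure (n := n) h𝒳
  set V : ℝ≥0∞ := featureMeasure 𝒳 n Set.univ
  have hV : V ≠ ∞ := measure_ne_top _ _
  set D : ℝ≥0∞ := n * d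
  have hD : D ≠ ∞ := ENNReal.mul_ne_top (by simp) (by simp)
  set c : ℝ≥0∞ := ENNReal.ofReal (ε / 2) ^ p
  have hc : c ≠ 0 := (ENNReal.rpow_pos (by simpa using hε) ENNReal.ofReal_ne_top).ne'
  set U : ℝ≥0∞ := ENNReal.ofReal (2 * M) ^ p
  have hU : U ≠ ∞ := ENNReal.rpow_ne_top_of_nonneg hp.le ENNReal.ofReal_ne_top
  have hlin : ∀ A : ℝ≥0∞, A ≠ ∞ → ∀ᶠ x in 𝓝[>] (0 : ℝ≥0∞), A * x ≤ c / 2 := fun A hA => by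
    have h : Tendsto (fun x => A * x) (𝓝[>] (0 : ℝ≥0∞)) (𝓝 (A * 0)) :=
      (ENNReal.Tendsto.const_mul tendsto_id (Or.inr hA)).mono_left nhdsWithin_le_nhds
    rw [mul_zero] at h
    exact h.eventually_le_const (ENNReal.half_pos hc)
  obtain ⟨β, hβ, hβ0⟩ := ((hlin (D * U) (ENNReal.mul_ne_top hD hU)).and self_mem_nhdsWithin).exists
  have hτlim : Tendsto (fun τ : ℝ => ENNReal.ofReal τ ^ p) (𝓝[>] 0) (𝓝[>] 0) := by
    refine tendsto_nhdsWithin_iff.2 ⟨?_, ?_⟩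
    · have h : Continuous fun τ : ℝ => ENNReal.ofReal τ ^ p :=
        ENNReal.continuous_rpow_const.comp ENNReal.continuous_ofReal
      have := h.tendsto 0
      simp only [ENNReal.ofReal_zero, ENNReal.zero_rpow_of_pos hp] at this
      exact this.mono_left nhdsWithin_le_nhds
    · filter_upwards [self_mem_nhdsWithin] with τ hτ
      exact ENNReal.rpow_pos (ENNReal.ofReal_pos.2 hτ) ENNReal.ofReal_ne_top
  obtain ⟨τ, hτ, hτ0⟩ := ((hτlim.eventually (hlin (D * V) (ENNReal.mul_ne_top hD hV))).and
    self_mem_nhdsWithin).exists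
  refine ⟨τ, hτ0, β, (Set.mem_Ioi.1 hβ0).ne', fun f g hf hg hB => ?_⟩
  have hsum : ∀ X G (a : ℝ), (∀ v i, |f X G v i - g X G v i| ≤ a) →
      ∑ v, ∑ i, ‖f X G v i - g X G v i‖ₑ ^ p ≤ D * ENNReal.ofReal a ^ p := by
    intro X G a ha
    refine (Finset.sum_le_sum fun v _ => Finset.sum_le_sum fun i _ =>
      ENNReal.rpow_le_rpow (?_ : _ ≤ ENNReal.ofReal a) hp.le).trans ?_
    · rw [Real.enorm_eq_ofReal_abs]
      exact ENNReal.ofReal_le_ofReal (ha v i)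
    · simp [D, mul_assoc]
  refine lt_of_le_of_lt (iSup_le fun G => ?_)
    ((ENNReal.ofReal_lt_ofReal_iff hε).2 (half_lt_self hε))
  obtain ⟨B, hBβ, hBτ⟩ := hB G
  rw [one_div, ENNReal.rpow_inv_le_iff hp]
  let B' := toMeasurable (featureMeasure 𝒳 n) B
  calc ∫⁻ X, ∑ v, ∑ i, ‖f X G v i - g X G v i‖ₑ ^ p ∂(featureMeasure 𝒳 n)
      ≤ ∫⁻ X, D * ENNReal.ofReal τ ^ p + B'.indicator (fun _ => D * U) X
          ∂(featureMeasure 𝒳 n) := by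
        refine lintegral_mono fun X => ?_
        by_cases hX : X ∈ B'
        · rw [Set.indicator_of_mem hX]
          refine (hsum X G (2 * M) fun v i => ?_).trans le_add_self
          exact (abs_sub _ _).trans (by linarith [hf X G v i, hg X G v i])
        · rw [Set.indicator_of_notMem hX, add_zero]
          exact hsum X G τ (hBτ X fun h => hX (subset_toMeasurable _ _ h))
    _ = D * V * ENNReal.ofReal τ ^ p + D * U * featureMeasure 𝒳 n B := by
        rw [lintegral_add_left measurable_const, lintegral_const,
          lintegral_indicator_const (measurableSet_toMeasurable _ _), measure_toMeasurable]
        ring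
    _ ≤ c / 2 + c / 2 := add_le_add hτ ((mul_le_mul_right hBβ _).trans hβ)
    _ = c := ENNReal.add_halves c

/-! ### Approximation of the labels -/

/-- Finitely many vectors can be projected to numbers that are far apart. -/
theorem exists_dotProduct_separated {k : ℕ} {J : Type*} [Finite J] (A : J → Vec k) (B : ℝ) :
    ∃ w : Vec k, ∀ j j', A j ≠ A j' → B ≤ |w ⬝ᵥ A j - w ⬝ᵥ A j'| := by
  obtain ⟨u, hu⟩ := exists_dotProduct_injOn (Set.finite_range A)
  have h : ∀ᶠ r : ℝ in atTop, ∀ j j', A j ≠ A j' → B ≤ r * |u ⬝ᵥ A j - u ⬝ᵥ A j'| := by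
    refine eventually_all.2 fun j => eventually_all.2 fun j' => ?_
    by_cases hj : A j = A j'
    · simp [hj]
    · have hpos : 0 < |u ⬝ᵥ A j - u ⬝ᵥ A j'| :=
        abs_pos.2 (sub_ne_zero.2 fun h => hj (hu ⟨j, rfl⟩ ⟨j', rfl⟩ h))
      filter_upwards [(tendsto_id.atTop_mul_const hpos).eventually_ge_atTop B] with r hr _ using hr
  obtain ⟨r, hr, hr0⟩ := (h.and (eventually_ge_atTop 0)).exists
  refine ⟨r • u, fun j j' hj => ?_⟩
  rw [smul_dotProduct, smul_dotProduct, smul_eq_mul, smul_eq_mul, ← mul_sub, abs_mul,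
    abs_of_nonneg hr0]
  exact hr j j' hj

/-- The input embedding used here: the absolute encoding `a` translates the feature vector `x` in
one coordinate. -/
def shiftFeature (i₀ : Fin d) (w : Vec k) (x : Vec d) (a : Vec k) : Vec d :=
  x + Pi.single i₀ (w ⬝ᵥ a)

/-- Outside a set of small measure, quantized features of the nodes are pairwise distinct, come from
a finite set, and determine the initial label `Φ₀ (x, a)` up to an error `τ`. -/
theorem exists_quantized_labels (S : StructuralEncoding k C) (h𝒳 : IsCompact 𝒳) (x₀ : 𝒳)
    (i₀ : Fin d) (Φ₀ : 𝒳 × Vec k → 𝒳) (hΦ₀ : ∀ c : Vec k, Measurable fun x : 𝒳 => Φ₀ (x, c))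
    {β : ℝ≥0∞} (hβ : β ≠ 0) {τ : ℝ} (hτ : 0 < τ) :
    ∃ (w : Vec k) (Q : Vec d → Vec d) (F : Set (Vec d)) (ρ : Vec d → 𝒳), Shallow Q ∧ F.Finite ∧
      ∀ G : SimpleGraph (Fin n), ∃ B, featureMeasure 𝒳 n B ≤ β ∧ ∀ X ∉ B,
        (Function.Injective fun v => Q (shiftFeature i₀ w (X v) (S.absEnc G v))) ∧
        ∀ v, Q (shiftFeature i₀ w (X v) (S.absEnc G v)) ∈ F ∧
          dist (ρ (Q (shiftFeature i₀ w (X v) (S.absEnc G v)))) (Φ₀ (X v, S.absEnc G v)) ≤ τ := by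
  classical
  have := isFiniteMeasure_featureMeasure (n := n) h𝒳
  have := isCompact_iff_compactSpace.1 h𝒳
  let ν := featureMeasure 𝒳 n
  let A : SimpleGraph (Fin n) × Fin n → Vec k := fun j => S.absEnc j.1 j.2
  have hβ3 : β / 3 ≠ 0 := ENNReal.div_ne_zero.2 ⟨hβ, by simp⟩
  obtain ⟨M, hM⟩ := h𝒳.isBounded.exists_norm_le
  have hMi : ∀ (x : 𝒳) i, |(x : Vec d) i| ≤ M := fun x i => (norm_le_pi_norm _ i).trans (hM x x.2)
  -- a set on which all initial label maps are uniformly continuous, up to the error `τ`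
  obtain ⟨K, hK, η₁, hη₁, hKη⟩ : ∃ K : Set 𝒳, ν {X | ∃ v, X v ∉ K} ≤ β / 3 ∧ ∃ η > 0,
      ∀ x ∈ K, ∀ x' ∈ K, dist x x' ≤ η → ∀ j, dist (Φ₀ (x, A j)) (Φ₀ (x', A j)) ≤ τ := by
    have hmeas : Measurable fun (x : 𝒳) j => (Φ₀ (x, A j) : Vec d) :=
      measurable_pi_lambda _ fun j => measurable_subtype_coe.comp (hΦ₀ (A j))
    have hbd : ∀ x : 𝒳, ‖fun j => (Φ₀ (x, A j) : Vec d)‖ ≤ max M 0 := fun x =>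
      (pi_norm_le_iff_of_nonneg (le_max_right _ _)).2 fun j =>
        (hM _ (Φ₀ (x, A j)).2).trans (le_max_left _ _)
    have hfin : IsFiniteMeasure (Measure.sum fun v : Fin n => ν.map fun X => X v) := by
      rw [Measure.sum_fintype]
      infer_instance
    obtain ⟨K, hK, η, hη, hKη⟩ := exists_measurableSet_dist_le
      (Measure.sum fun v : Fin n => ν.map fun X => X v) hmeas.aestronglyMeasurable hbd hβ3 hτ
    refine ⟨K, ?_, η, hη, fun x hx x' hx' h j => (dist_le_pi_dist _ _ j).trans (hKη x hx x' hx' h)⟩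
    calc ν {X | ∃ v, X v ∉ K} = ν (⋃ v, (fun X => X v) ⁻¹' Kᶜ) := by
          congr 1; ext X; simp
      _ ≤ ∑ v, ν ((fun X => X v) ⁻¹' Kᶜ) := measure_iUnion_fintype_le _ _
      _ ≤ ∑ v, ν.map (fun X => X v) Kᶜ := Finset.sum_le_sum fun v _ =>
          Measure.le_map_apply (measurable_pi_apply v).aemeasurable _
      _ ≤ Measure.sum (fun v : Fin n => ν.map fun X => X v) Kᶜ := by
          rw [Measure.sum_fintype, Measure.finsetSum_apply]
      _ ≤ β / 3 := hK
  -- the translates of `𝒳` belonging to distinct absolute encodings have distance more than `1`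
  obtain ⟨w, hw⟩ := exists_dotProduct_separated A (2 * M + 2)
  let z : (Fin n → 𝒳) → SimpleGraph (Fin n) → Fin n → Vec d := fun X G v =>
    shiftFeature i₀ w (X v) (S.absEnc G v)
  have hz : ∀ (x x' : 𝒳) (j j' : SimpleGraph (Fin n) × Fin n) (η : ℝ), 0 ≤ η → η ≤ 1 →
      (∀ i, |shiftFeature i₀ w x (A j) i - shiftFeature i₀ w x' (A j') i| ≤ η) →
      A j = A j' ∧ dist x x' ≤ η := by
    intro x x' j j' η hη0 hη1 h
    have hA : A j = A j' := by
      by_contra hne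
      have h0 := h i₀
      simp only [shiftFeature, Pi.add_apply, Pi.single_eq_same] at h0
      have h1 := hw j j' hne
      have h2 : |w ⬝ᵥ A j - w ⬝ᵥ A j'| ≤ |(x : Vec d) i₀ + w ⬝ᵥ A j - ((x' : Vec d) i₀ + w ⬝ᵥ A j')|
          + |(x' : Vec d) i₀ - (x : Vec d) i₀| := by
        refine le_trans (le_of_eq ?_) (abs_add_le _ _)
        congr 1; ring
      have h3 := (abs_sub ((x' : Vec d) i₀) ((x : Vec d) i₀)).trans
        (add_le_add (hMi x' i₀) (hMi x i₀))
      linarith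
    refine ⟨hA, (dist_pi_le_iff hη0).2 fun i => ?_⟩
    have := h i
    rw [hA] at this
    simpa [shiftFeature, Real.dist_eq] using this
  obtain ⟨R, hR⟩ : ∃ R, ∀ (x : 𝒳) j i, |shiftFeature i₀ w x (A j) i| ≤ R := by
    obtain ⟨R, hR⟩ := (Set.finite_range fun j => ‖(Pi.single i₀ (w ⬝ᵥ A j) : Vec d)‖).bddAbove
    refine ⟨M + R, fun x j i => (norm_le_pi_norm (shiftFeature i₀ w x (A j)) i).trans ?_⟩
    exact (norm_add_le _ _).trans (add_le_add (hM x x.2) (hR ⟨j, rfl⟩))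
  have hzm : ∀ G v i, Measurable fun X => z X G v i := fun G v i => by
    have : Measurable fun X : Fin n → 𝒳 => (X v : Vec d) i :=
      (measurable_pi_apply i).comp (measurable_subtype_coe.comp (measurable_pi_apply v))
    exact this.add_const _
  -- a scale at which two nodes are rarely close to each other
  obtain ⟨η, hη, hη0, hηle⟩ : ∃ η, ν (⋃ q : SimpleGraph (Fin n) × {q : Fin n × Fin n // q.1 ≠ q.2},
      {X | |z X q.1 q.2.1.1 i₀ - z X q.1 q.2.1.2 i₀| ≤ η}) ≤ β / 3 ∧ 0 < η ∧ η ≤ min 1 η₁ := by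
    refine ((eventually_measure_iUnion_le ν
      (fun (q : SimpleGraph (Fin n) × {q : Fin n × Fin n // q.1 ≠ q.2}) δ =>
        {X | |z X q.1 q.2.1.1 i₀ - z X q.1 q.2.1.2 i₀| ≤ δ}) (fun q δ => ?_)
      (fun q δ δ' h X hX => le_trans hX h) (fun q => ?_) hβ3).and
      (Ioc_mem_nhdsGT (lt_min one_pos hη₁))).exists
    · exact measurableSet_le (((hzm _ _ _).sub (hzm _ _ _)).abs) measurable_const
    · refine measure_mono_null (fun X hX => ?_) (featureMeasure_sub_eq h𝒳 q.2.2 i₀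
        (w ⬝ᵥ S.absEnc q.1 q.2.1.2 - w ⬝ᵥ S.absEnc q.1 q.2.1.1))
      have h0 : |z X q.1 q.2.1.1 i₀ - z X q.1 q.2.1.2 i₀| ≤ 0 :=
        le_of_forall_gt_imp_ge_of_dense fun δ hδ => Set.mem_iInter₂.1 hX δ hδ
      have h1 := abs_eq_zero.1 (le_antisymm h0 (abs_nonneg _))
      simp only [z, shiftFeature, Pi.add_apply, Pi.single_eq_same] at h1
      change (X _ : Vec d) i₀ - (X _ : Vec d) i₀ = _
      linarith
  obtain ⟨T, hT⟩ := exists_quantizer d R η hη0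
  -- gaps so short that they are rarely hit
  obtain ⟨δ, hδ, hδ0⟩ : ∃ δ, ν (⋃ q : SimpleGraph (Fin n) × Fin n × Fin d × T,
      {X | q.2.2.2 < z X q.1 q.2.1 q.2.2.1 ∧ z X q.1 q.2.1 q.2.2.1 < q.2.2.2 + δ}) ≤ β / 3 ∧
      0 < δ := by
    refine ((eventually_measure_iUnion_le ν
      (fun (q : SimpleGraph (Fin n) × Fin n × Fin d × T) δ =>
        {X | q.2.2.2 < z X q.1 q.2.1 q.2.2.1 ∧ z X q.1 q.2.1 q.2.2.1 < q.2.2.2 + δ})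
      (fun q δ => ?_) (fun q δ δ' h X hX => ⟨hX.1, hX.2.trans_le (by linarith)⟩) (fun q => ?_) hβ3).and
      self_mem_nhdsWithin).exists
    · exact (measurableSet_lt measurable_const (hzm _ _ _)).inter
        (measurableSet_lt (hzm _ _ _) measurable_const)
    · refine measure_mono_null (fun X hX => ?_) (measure_empty (μ := ν))
      have hX := Set.mem_iInter₂.1 hX
      have h1 := (hX 1 one_pos).1
      have h2 := (hX (z X q.1 q.2.1 q.2.2.1 - q.2.2.2) (by simpa using h1)).2
      simp at h2
  obtain ⟨Q, hQ, hQF, hQη⟩ := hT δ hδ0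
  -- the label attached to a quantized feature: that of any point of `K` with this feature
  obtain ⟨ρ, hρ⟩ : ∃ ρ : Vec d → 𝒳, ∀ x ∈ K, ∀ j,
      (∀ i, shiftFeature i₀ w x (A j) i ∉ gaps T δ) →
      dist (ρ (Q (shiftFeature i₀ w x (A j)))) (Φ₀ (x, A j)) ≤ τ := by
    let good : Vec d → 𝒳 × (SimpleGraph (Fin n) × Fin n) → Prop := fun y q =>
      q.1 ∈ K ∧ (∀ i, shiftFeature i₀ w q.1 (A q.2) i ∉ gaps T δ) ∧
        Q (shiftFeature i₀ w q.1 (A q.2)) = y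
    refine ⟨fun y => if h : ∃ q, good y q then Φ₀ (h.choose.1, A h.choose.2) else x₀,
      fun x hx j hxj => ?_⟩
    have h : ∃ q, good (Q (shiftFeature i₀ w x (A j))) q := ⟨(x, j), hx, hxj, rfl⟩
    beta_reduce
    rw [dif_pos h]
    obtain ⟨h1, h2, h3⟩ := h.choose_spec
    obtain ⟨h4, h5⟩ := hz _ _ _ _ η hη0.le (hηle.trans (min_le_left _ _))
      (hQη _ _ (fun i => ⟨hR _ _ i, h2 i⟩) (fun i => ⟨hR _ _ i, hxj i⟩) h3)
    rw [h4]
    exact hKη _ h1 _ hx (h5.trans (hηle.trans (min_le_right _ _))) j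
  refine ⟨w, Q, _, ρ, hQ, hQF, fun G => ⟨_, (measure_union_le _ _).trans
    ((add_le_add ((measure_union_le _ _).trans (add_le_add hK hη)) hδ).trans
      (ENNReal.add_thirds β).le), fun X hX => ?_⟩⟩
  simp only [Set.mem_union, not_or] at hX
  obtain ⟨⟨hXK, hXη⟩, hXδ⟩ := hX
  have hKv : ∀ v, X v ∈ K := fun v => by
    by_contra h
    exact hXK ⟨v, h⟩
  have hgap : ∀ v i, z X G v i ∉ gaps T δ := by
    rintro v i ⟨m, hm, hmz⟩
    exact hXδ (Set.mem_iUnion.2 ⟨(G, v, i, ⟨m, hm⟩), hmz⟩)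
  have hbox : ∀ v i, |z X G v i| ≤ R ∧ z X G v i ∉ gaps T δ := fun v i =>
    ⟨hR _ (G, v) i, hgap v i⟩
  refine ⟨fun u v huv => ?_, fun v => ⟨⟨_, hbox v, rfl⟩, hρ _ (hKv v) (G, v) (hgap v)⟩⟩
  by_contra hne
  exact hXη (Set.mem_iUnion.2 ⟨(G, ⟨(u, v), hne⟩), hQη _ _ (hbox u) (hbox v) huv i₀⟩)

/-- A stack of layers extended by the translating input embedding is a bias-GT network. -/
theorem Realizable.exists_biasGT {T : (Fin n → Fin n → C) → (Fin n → Vec d) → Fin n → Vec d}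
    (hT : Realizable T) (i₀ : Fin d) (w : Vec k) :
    ∃ (r : ℕ) (g : BiasGT d k 1 1 1 r C), ∀ (S : StructuralEncoding k C) (X : Fin n → Vec d)
      (G : SimpleGraph (Fin n)),
      g.eval S X G = T (S.relEnc G) fun v => shiftFeature i₀ w (X v) (S.absEnc G v) := by
  obtain ⟨r, hr⟩ := hT
  obtain ⟨ls, hls⟩ := hr r le_rfl
  refine ⟨r, ⟨Matrix.of fun i => Sum.elim (Pi.single i 1) (Pi.single (M := fun _ => Vec k) i₀ w i),
    0, ls⟩, fun S X G => ?_⟩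
  rw [BiasGT.eval, hls]
  congr 1
  ext v i
  rw [BiasGT.embed, shiftFeature, add_zero, Pi.add_apply]
  simp only [Matrix.mulVec, dotProduct, Matrix.of_apply, Fintype.sum_sum_type, Sum.elim_inl,
    Sum.elim_inr]
  rw [show ∑ x, (Pi.single i 1 : Vec d) x * X v x = X v i by simp [Pi.single_apply]]
  by_cases h : i = i₀
  · subst h; simp
  · simp [h]

theorem dp_self {p : ℝ} (hp : 0 < p) (f : (Fin n → 𝒳) → SimpleGraph (Fin n) → Fin n → Vec d) :
    dp p f f = 0 := by
  simp [dp, ENNReal.zero_rpow_of_pos, hp]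

end SEGWL

open SEGWL

theorem theorem2 {d k : ℕ} {C : Type*} (S : SEGWL.StructuralEncoding k C) (hS : S.Regular)
    (n : ℕ) (p : ℝ) (hp : 1 < p) (ε : ℝ) (hε : 0 < ε) (t : ℕ)
    (𝒳 : Set (SEGWL.Vec d)) (h𝒳 : IsCompact 𝒳)
    (Φ₀ : 𝒳 × SEGWL.Vec k → 𝒳) (hΦ₀ : ∀ c : SEGWL.Vec k, Measurable fun x : 𝒳 => Φ₀ (x, c))
    (Φ : Multiset (𝒳 × C) → 𝒳) (hΦ : SEGWL.ExtendsContinuously n Φ) :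
    ∃ (h dk dv r : ℕ) (g : SEGWL.BiasGT d k h dk dv r C),
      SEGWL.dp p
        (fun (X : Fin n → 𝒳) (G : SimpleGraph (Fin n)) => SEGWL.labelFun S Φ₀ Φ t X G)
        (fun (X : Fin n → 𝒳) (G : SimpleGraph (Fin n)) =>
          g.eval S (fun v => (X v : SEGWL.Vec d)) G)
        < ENNReal.ofReal ε := by
  have hp0 : 0 < p := one_pos.trans hp
  -- if there are no features at all, any two functions agree
  by_cases hne : Nonempty (Fin n → 𝒳) ∧ 0 < n ∧ 0 < d
  swap
  · refine ⟨1, 1, 1, 0, ⟨0, 0, []⟩, ?_⟩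
    convert (dp_self hp0 _).trans_lt (ENNReal.ofReal_pos.2 hε) using 2
    ext X G v i
    exact absurd ⟨⟨X⟩, v.pos, i.pos⟩ hne
  obtain ⟨⟨X₀⟩, hn, hd⟩ := hne
  have := isCompact_iff_compactSpace.1 h𝒳
  obtain ⟨M, hM⟩ := h𝒳.isBounded.exists_norm_le
  have hMi : ∀ (x : 𝒳) i, |(x : Vec d) i| ≤ M := fun x i => (norm_le_pi_norm _ i).trans (hM x x.2)
  have hM0 : 0 ≤ M := (abs_nonneg _).trans (hMi (X₀ ⟨0, hn⟩) ⟨0, hd⟩)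
  obtain ⟨τ, hτ, β, hβ, hdp⟩ := exists_dp_lt (n := n) h𝒳 hp0 hε M
  have hcont : Continuous fun (g₀ : Fin n → 𝒳) G => refineLabels S Φ G g₀ t :=
    continuous_pi fun G => continuous_refineLabels S hΦ G t
  obtain ⟨τ₁, hτ₁, hτ₁τ⟩ := Metric.uniformContinuous_iff.1
    (CompactSpace.uniformContinuous_of_continuous hcont) τ hτ
  obtain ⟨w, Q, F, ρ, hQ, hF, hB⟩ := exists_quantized_labels (n := n) S h𝒳 (X₀ ⟨0, hn⟩)
    ⟨0, hd⟩ Φ₀ hΦ₀ hβ (half_pos hτ₁)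
  obtain ⟨T, hT, hTS⟩ := exists_realizable_refineLabels (n := n) hd S hS Φ hF ρ t
  obtain ⟨clamp, hclamp, hclampM, hclamp_id⟩ := shallow_clamp (d := d) M hM0
  obtain ⟨r, g, hg⟩ := ((Realizable.nodewise hclamp).comp
    (hT.comp (Realizable.nodewise hQ))).exists_biasGT (k := k) ⟨0, hd⟩ w
  refine ⟨1, 1, 1, r, g, hdp _ _ (fun X G v i => hMi _ i)
    (fun X G v i => by rw [hg]; exact hclampM _ i) fun G₀ => ?_⟩
  obtain ⟨B, hBβ, hBX⟩ := hB G₀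
  refine ⟨B, hBβ, fun X hX v i => ?_⟩
  obtain ⟨hinj, hval⟩ := hBX X hX
  rw [hg]
  beta_reduce
  rw [hTS G₀ _ hinj (fun v => (hval v).1), hclamp_id _ (hMi _), labelFun, label_eq_refineLabels]
  have hclose : dist (fun v => Φ₀ (X v, S.absEnc G₀ v))
      (fun v => ρ (Q (shiftFeature ⟨0, hd⟩ w (X v) (S.absEnc G₀ v)))) < τ₁ := by
    refine lt_of_le_of_lt ((dist_pi_le_iff (half_pos hτ₁).le).2 fun v => ?_) (half_lt_self hτ₁)
    rw [dist_comm]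
    exact (hval v).2
  -- the distance of the label maps dominates that of every entry, for every graph
  have hG := (dist_le_pi_dist (fun G => refineLabels S Φ G (fun v => Φ₀ (X v, S.absEnc G₀ v)) t)
    (fun G => refineLabels S Φ G
      (fun v => ρ (Q (shiftFeature ⟨0, hd⟩ w (X v) (S.absEnc G₀ v)))) t) G₀).trans
    (hτ₁τ hclose).le
  rw [← Real.dist_eq]
  exact (dist_le_pi_dist _ _ i).trans ((dist_le_pi_dist _ _ v).trans hG)
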